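/- An agent has a finite deadline $T>0$; $\tau\in[0,T]$ denotes the time remaining. Until something arrives she splits one unit of effort per unit of time between a doing arm (share $a_\tau\in[0,1]$) and a thinking arm (share $1-a_\tau$), at flow cost $c>0$. With prior probability $\bar p\in(0,1)$ the doing arm is good and yields a solution, worth $B>0$, at rate $\lambda a_\tau$ with $\lambda>0$; otherwise it never does. The thinking arm yields progress at rate $\mu(1-a_\tau)$ with $\mu>0$; progress with time $\tau$ remaining is worth $V(\tau)$. Here $V:[0,\infty)\to\mathbb R$ is three times continuously differentiable with $V(0)=0$, $V'>0$ and $-V''(\tau)/V'(\tau)\ge\bar p\lambda$ for all $\tau\ge0$. The first arrival ends the game. A policy is a measurable function $a:[0,T]\to[0,1]$; write $A_\tau=\int_\tau^T a_s\,ds$ and $p_\tau=\bar p e^{-\lambda A_\tau}/(\bar p e^{-\lambda A_\tau}+1-\bar p)$. A policy is optimal if it maximizes, over all policies, \[\int_0^T e^{-\mu(T-\tau-A_\tau)}\,(1-\bar p+\bar p e^{-\lambda A_\tau})\,\bigl(\mu(1-a_\tau)V(\tau)+\lambda a_\tau p_\tau B-c\bigr)\,d\tau .\] Then an optimal policy exists,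 and every optimal policy takes, up to a null set of times, one of the following forms: (1) the agent exclusively uses the doing arm ($a_\tau=1$ on $[0,T]$); (2) she starts by thinking and then switches to doing until the deadline: for some $0<s<T$, $a_\tau=0$ for $s<\tau<T$ and $a_\tau=1$ for $\tau<s$; (3) she begins with doing, switches to thinking, and returns to doing when little time remains: for some $0<s<r<T$, $a_\tau=1$ for $r<\tau<T$, $a_\tau=0$ for $s<\tau<r$, and $a_\tau=1$ for $\tau<s$. In particular, up to a null set, the times at which the agent puts effort into thinking form a single (possibly empty) interval. -/

import Mathlib

open MeasureTheory Set

noncomputable section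

/-- The primitives of the problem: deadline `T`, flow cost of effort `c`, arrival rate `lam` of a
good doing arm, arrival rate `mu` of the thinking arm, payoff `B` of a solution, prior `pbar` that
the doing arm is good, and continuation payoff `V τ` when progress occurs with time `τ` remaining. -/
structure DoThinkProblem where
  T : ℝ
  c : ℝ
  lam : ℝ
  mu : ℝ
  B : ℝ
  pbar : ℝ
  V : ℝ → ℝ

namespace DoThinkProblem

/-- A policy assigns to the time remaining `τ ∈ [0, T]` the share `a τ ∈ [0, 1]` of the unit effort
that goes to the doing arm while nothing has arrived; the share `1 - a τ` goes to thinking.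
It is measurable on `[0, T]`. -/
def IsPolicy (M : DoThinkProblem) (a : ℝ → ℝ) : Prop :=
  AEMeasurable a (volume.restrict (Icc 0 M.T)) ∧ ∀ τ ∈ Icc 0 M.T, a τ ∈ Icc (0 : ℝ) 1

/-- Past effort on the doing arm when time `τ` remains. -/
def pastEffort (M : DoThinkProblem) (a : ℝ → ℝ) (τ : ℝ) : ℝ :=
  ∫ s in τ..M.T, a s

/-- Posterior belief that the doing arm is good, after effort `A` on it without a solution. -/
def belief (M : DoThinkProblem) (A : ℝ) : ℝ :=
  M.pbar * Real.exp (-M.lam * A) / (M.pbar * Real.exp (-M.lam * A) + (1 - M.pbar))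

/-- Probability that no progress has occurred when time `τ` remains and past effort on the doing
arm is `A` (so that past effort on the thinking arm is `T - τ - A`). -/
def probNoProgress (M : DoThinkProblem) (τ A : ℝ) : ℝ :=
  Real.exp (-M.mu * (M.T - τ - A))

/-- Probability that no solution has arrived after effort `A` on the doing arm. -/
def probNoSolution (M : DoThinkProblem) (A : ℝ) : ℝ :=
  1 - M.pbar + M.pbar * Real.exp (-M.lam * A)

/-- Expected flow payoff, net of the flow cost, of effort share `x` on the doing arm. -/
def flowPayoff (M : DoThinkProblem) (x A τ : ℝ) : ℝ :=
  M.mu * (1 - x) * M.V τ + M.lam * x * M.belief A * M.B - M.c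

/-- The expected payoff of a policy. -/
def payoff (M : DoThinkProblem) (a : ℝ → ℝ) : ℝ :=
  ∫ τ in (0 : ℝ)..M.T,
    M.probNoProgress τ (M.pastEffort a τ) * M.probNoSolution (M.pastEffort a τ) *
      M.flowPayoff (a τ) (M.pastEffort a τ) τ

/-- A policy is optimal if no policy has a larger expected payoff. -/
def IsOptimal (M : DoThinkProblem) (a : ℝ → ℝ) : Prop :=
  M.IsPolicy a ∧ ∀ b, M.IsPolicy b → M.payoff b ≤ M.payoff a

/-- With time remaining in `(r, s)` the agent exclusively uses the doing arm. -/
def DoesOn (a : ℝ → ℝ) (r s : ℝ) : Prop :=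
  ∀ᵐ τ ∂(volume.restrict (Ioo r s)), a τ = 1

/-- With time remaining in `(r, s)` the agent exclusively uses the thinking arm. -/
def ThinksOn (a : ℝ → ℝ) (r s : ℝ) : Prop :=
  ∀ᵐ τ ∂(volume.restrict (Ioo r s)), a τ = 0

/-- Doing throughout. -/
def DoThroughout (M : DoThinkProblem) (a : ℝ → ℝ) : Prop :=
  DoesOn a 0 M.T

/-- Thinking first, then doing from the moment when time `s` remains until the deadline. -/
def ThinkThenDo (M : DoThinkProblem) (a : ℝ → ℝ) : Prop :=
  ∃ s, 0 < s ∧ s < M.T ∧ ThinksOn a s M.T ∧ DoesOn a 0 s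

/-- Doing first, then thinking from the moment when time `r` remains, then doing again from the
moment when time `s` remains until the deadline. -/
def DoThinkDo (M : DoThinkProblem) (a : ℝ → ℝ) : Prop :=
  ∃ s r, 0 < s ∧ s < r ∧ r < M.T ∧ DoesOn a r M.T ∧ ThinksOn a s r ∧ DoesOn a 0 s

/-- The times at which the agent puts effort into thinking form one interval (possibly empty),
up to a null set. -/
def ThinksAtMostOnce (M : DoThinkProblem) (a : ℝ → ℝ) : Prop :=
  ∃ I : Set ℝ, I.OrdConnected ∧
    ∀ᵐ τ ∂(volume.restrict (Icc 0 M.T)), 0 < 1 - a τ ↔ τ ∈ I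

end DoThinkProblem

end

/-! The integrand of the payoff is affine in the share `a`, and `a` is minus the derivative of past
effort `A`. Integrating by parts removes `a`: the payoff depends on the path `A` alone
(`Standing.payoff_eq`) and is continuous in it for the sup norm. The admissible paths form a compact
set by Arzelà–Ascoli, which gives existence.

For the form of an optimum, the first variation in the direction `b - a` is the integral of `(b - a)
* φ`, where the switching function `φ` starts from a positive value at the deadline and has
derivative `g`, the marginal flow along the path. Hence `a = 1` where `φ > 0` and `a = 0` where `φ <
0`, almost everywhere.

The sign of `g` is that of the advantage `π (c + μ (B - V)) - μ (c + V')`, with `π` the hazard rate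
of a solution. As `τ` grows, `A` falls and `π` rises; this raises the advantage once it is
nonnegative, because then `c + μ (B - V) > 0`. For fixed `π ≤ λ p̄` the advantage is nondecreasing
in `τ`, by the curvature bound on `V`. So `g` changes sign at most once, from negative to positive,
and `φ` falls and then rises: it is positive outside one interval. Within that interval either `φ <
0`, or `g` vanishes identically. In the latter case strict monotonicity forces `A = 0`, so the agent
is thinking there too. -/

/-! ### Single crossing and the sign of a primitive -/

/-- A primitive `φ` with `φ 0 > 0` of a function that changes sign at most once, from negative to
positive, is positive off an interval `[s, r]`; inside, it is negative unless it vanishes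
identically. -/
theorem exists_interval_of_single_crossing {T φ₀ : ℝ} {g φ : ℝ → ℝ} (hφ₀ : 0 < φ₀)
    (hg : ContinuousOn g (Icc 0 T)) (hφ : ∀ s, φ s = φ₀ + ∫ t in (0 : ℝ)..s, g t)
    (h0 : ∀ x ∈ Icc 0 T, ∀ y ∈ Icc 0 T, x ≤ y → 0 ≤ g x → 0 ≤ g y)
    (h1 : ∀ x ∈ Icc 0 T, ∀ y ∈ Icc 0 T, x ≤ y → 0 < g x → 0 < g y) :
    (∃ z, ∀ t ∈ Icc 0 T, t ≠ z → 0 < φ t) ∨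
      ∃ s r, 0 < s ∧ s < r ∧ r ≤ T ∧ (∀ t ∈ Ico 0 s, 0 < φ t) ∧ (∀ t ∈ Ioc r T, 0 < φ t) ∧
        ((∀ t ∈ Ioo s r, φ t < 0) ∨ ∀ t ∈ Ioo s r, g t = 0) := by
  have hint : ∀ x ∈ Icc 0 T, ∀ y ∈ Icc 0 T, IntervalIntegrable g volume x y := fun x hx y hy =>
    (hg.mono (uIcc_subset_Icc hx hy)).intervalIntegrable
  have hsub : ∀ x ∈ Icc 0 T, ∀ y ∈ Icc 0 T, φ y - φ x = ∫ t in x..y, g t := by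
    intro x hx y hy
    have h0T : (0 : ℝ) ∈ Icc 0 T := ⟨le_rfl, hx.1.trans hx.2⟩
    rw [hφ, hφ, ← intervalIntegral.integral_interval_sub_left (hint 0 h0T y hy) (hint 0 h0T x hx)]
    ring
  -- after a point with `g > 0` the function increases strictly
  have hinc : ∀ z ∈ Icc 0 T, 0 < g z → ∀ x ∈ Icc 0 T, ∀ y ∈ Icc 0 T, z ≤ x → x < y →
      φ x < φ y := by
    intro z hz hgz x hx y hy hzx hxy
    have : 0 < ∫ t in x..y, g t := by
      apply intervalIntegral.intervalIntegral_pos_of_pos_on (hint x hx y hy) _ hxy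
      intro t ht
      exact h1 z hz t ⟨hx.1.trans ht.1.le, ht.2.le.trans hy.2⟩ (hzx.trans ht.1.le) hgz
    linarith [hsub x hx y hy]
  have hle : ∀ x ∈ Icc 0 T, ∀ y ∈ Icc 0 T, x ≤ y → (∀ t ∈ Icc x y, g t ≤ 0) → φ y ≤ φ x := by
    intro x hx y hy hxy h
    have := intervalIntegral.integral_nonneg (f := fun t => - g t) (μ := volume) hxy
      (fun t ht => neg_nonneg.2 (h t ht))
    rw [intervalIntegral.integral_neg] at this
    linarith [hsub x hx y hy]
  have hge : ∀ x ∈ Icc 0 T, ∀ y ∈ Icc 0 T, x ≤ y → (∀ t ∈ Icc x y, 0 ≤ g t) → φ x ≤ φ y := by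
    intro x hx y hy hxy h
    have := intervalIntegral.integral_nonneg (f := g) (μ := volume) hxy h
    linarith [hsub x hx y hy]
  by_cases hT : 0 ≤ T
  swap
  · exact Or.inl ⟨0, fun t ht => absurd (ht.1.trans ht.2) hT⟩
  have h0T : (0 : ℝ) ∈ Icc 0 T := ⟨le_rfl, hT⟩
  have hφc : ContinuousOn φ (Icc 0 T) := by
    have : ContinuousOn (fun s => ∫ t in (0 : ℝ)..s, g t) (Icc 0 T) := by
      have := intervalIntegral.continuousOn_primitive_interval' (hint 0 h0T T ⟨hT, le_rfl⟩)
        (left_mem_uIcc)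
      rwa [uIcc_of_le hT] at this
    exact (continuousOn_const.add this).congr fun s _ => hφ s
  have hφ0 : φ 0 = φ₀ := by simp [hφ]
  -- The endpoints `s` and `r` will be the least and greatest points of this compact set.
  set N : Set ℝ := Icc 0 T ∩ φ ⁻¹' Iic 0 with hN
  have hNc : IsCompact N :=
    isCompact_Icc.of_isClosed_subset (hφc.preimage_isClosed_of_isClosed isClosed_Icc isClosed_Iic)
      inter_subset_left
  have hord : ∀ x ∈ N, ∀ z ∈ N, ∀ y ∈ Icc x z, φ y ≤ 0 := by
    intro x hx z hz y hy
    by_contra! hpos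
    have hyT : y ∈ Icc 0 T := ⟨hx.1.1.trans hy.1, hy.2.trans hz.1.2⟩
    have : ∃ u ∈ Icc x y, 0 < g u := by
      by_contra! h
      have := hle x hx.1 y hyT hy.1 h
      have h2 : φ x ≤ 0 := hx.2
      linarith
    obtain ⟨u, hu, hgu⟩ := this
    have hyz : y < z := by
      rcases hy.2.lt_or_eq with h | h
      · exact h
      · have h2 : φ z ≤ 0 := hz.2
        rw [← h] at h2; linarith
    have h3 := hinc u ⟨hx.1.1.trans hu.1, hu.2.trans hyT.2⟩ hgu y hyT z hz.1 hu.2 hyz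
    have h2 : φ z ≤ 0 := hz.2
    linarith
  rcases N.eq_empty_or_nonempty with hemp | hne
  · refine Or.inl ⟨0, fun t ht _ => ?_⟩
    by_contra! h
    exact (hemp ▸ (⟨ht, h⟩ : t ∈ N) : t ∈ (∅ : Set ℝ))
  set s := sInf N
  set r := sSup N
  have hs : s ∈ N := hNc.sInf_mem hne
  have hr : r ∈ N := hNc.sSup_mem hne
  have hsr : s ≤ r := csInf_le_csSup hne hNc.bddBelow hNc.bddAbove
  have hlow : ∀ t ∈ Icc 0 T, t < s → 0 < φ t := fun t ht hts => by
    by_contra! h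
    exact absurd (csInf_le hNc.bddBelow (⟨ht, h⟩ : t ∈ N)) (not_le.2 hts)
  have hhigh : ∀ t ∈ Icc 0 T, r < t → 0 < φ t := fun t ht hts => by
    by_contra! h
    exact absurd (le_csSup hNc.bddAbove (⟨ht, h⟩ : t ∈ N)) (not_le.2 hts)
  rcases hsr.eq_or_lt with heq | hlt
  · refine Or.inl ⟨s, fun t ht hne => ?_⟩
    rcases hne.lt_or_gt with h | h
    · exact hlow t ht h
    · exact hhigh t ht (heq ▸ h)
  have hs0 : 0 < s := by
    rcases hs.1.1.lt_or_eq with h | h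
    · exact h
    · have h2 : φ s ≤ 0 := hs.2
      rw [← h, hφ0] at h2; linarith
  refine Or.inr ⟨s, r, hs0, hlt, hr.1.2, fun t ht => hlow t ⟨ht.1, ht.2.le.trans hs.1.2⟩ ht.2,
    fun t ht => hhigh t ⟨hr.1.1.trans ht.1.le, ht.2⟩ ht.1, ?_⟩
  -- Since `φ` falls and then rises and is nonpositive at both ends, it can reach `0` at an interior
  -- point `y` only by being flat: any strict rise would end above `0` at `r`, any strict fall would
  -- leave `φ y < 0`.
  by_cases hneg : ∀ t ∈ Ioo s r, φ t < 0
  · exact Or.inl hneg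
  right
  push Not at hneg
  obtain ⟨y, hy, hφy⟩ := hneg
  have hyT : y ∈ Icc 0 T := ⟨hs.1.1.trans hy.1.le, hy.2.le.trans hr.1.2⟩
  have hφr : φ r ≤ 0 := hr.2
  have hφs : 0 ≤ φ s := by
    have hcl : s ∈ closure (Ico 0 s) := by
      rw [closure_Ico hs0.ne]; exact ⟨hs0.le, le_rfl⟩
    have hcont : ContinuousWithinAt φ (Ico 0 s) s :=
      (hφc s hs.1).mono fun t ht => ⟨ht.1, ht.2.le.trans hs.1.2⟩
    exact isClosed_Ici.closure_subset_iff.2 (by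
      rintro _ ⟨t, ht, rfl⟩
      exact (hlow t ⟨ht.1, ht.2.le.trans hs.1.2⟩ ht.2).le)
      (hcont.mem_closure_image hcl)
  have hpos_false : ∀ u ∈ Ico s r, ¬ 0 < g u := by
    intro u hu hgu
    have huT : u ∈ Icc 0 T := ⟨hs.1.1.trans hu.1, hu.2.le.trans hr.1.2⟩
    rcases le_or_gt u y with h | h
    · have := hinc u huT hgu y hyT r hr.1 h hy.2
      linarith
    · -- `φ ≤ 0` on `[s, r]`; if `g` were negative on `[s, y]` then `φ y < 0`
      have hgy : ∀ t ∈ Icc s y, g t ≤ 0 := by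
        intro t ht
        by_contra! hgt
        have := hinc t ⟨hs.1.1.trans ht.1, ht.2.trans hyT.2⟩ hgt y hyT r hr.1 ht.2 hy.2
        linarith
      have hzero : ∃ t ∈ Icc s y, 0 ≤ g t := by
        by_contra! hneg
        have h4 : 0 < ∫ t in s..y, - g t :=
          intervalIntegral.intervalIntegral_pos_of_pos_on (hint s hs.1 y hyT).neg
            (fun t ht => neg_pos.2 (hneg t ⟨ht.1.le, ht.2.le⟩)) hy.1
        rw [intervalIntegral.integral_neg] at h4
        have h5 : φ s ≤ 0 := hs.2
        linarith [hsub s hs.1 y hyT]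
      obtain ⟨t, ht, hgt⟩ := hzero
      have htT : t ∈ Icc 0 T := ⟨hs.1.1.trans ht.1, ht.2.trans hyT.2⟩
      have h6 : φ y ≤ φ u := hge y hyT u huT h.le fun v hv =>
        h0 t htT v ⟨hyT.1.trans hv.1, hv.2.trans huT.2⟩ (ht.2.trans hv.1) hgt
      have := hinc u huT hgu u huT r hr.1 le_rfl hu.2
      linarith
  intro t ht
  refine le_antisymm (not_lt.1 (hpos_false t ⟨ht.1.le, ht.2⟩)) ?_
  have htT : t ∈ Icc 0 T := ⟨hs.1.1.trans ht.1.le, ht.2.le.trans hr.1.2⟩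
  by_contra! hgt
  -- then `g < 0` on `[s, t]`, so `φ < 0` right after `s`, and `φ` stays negative
  have hneg : ∀ u ∈ Icc s t, g u < 0 := by
    intro u hu
    by_contra! h
    exact absurd (h0 u ⟨hs.1.1.trans hu.1, hu.2.trans htT.2⟩ t htT hu.2 h) (not_le.2 hgt)
  have h7 : φ t < φ s := by
    have h4 : 0 < ∫ t in s..t, - g t :=
      intervalIntegral.intervalIntegral_pos_of_pos_on (hint s hs.1 t htT).neg
        (fun u hu => neg_pos.2 (hneg u ⟨hu.1.le, hu.2.le⟩)) ht.1
    rw [intervalIntegral.integral_neg] at h4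
    linarith [hsub s hs.1 t htT]
  have h5 : φ s ≤ 0 := hs.2
  rcases le_or_gt t y with h | h
  · have := hle t htT y hyT h fun v hv => not_lt.1 (hpos_false v ⟨ht.1.le.trans hv.1, hv.2.trans_lt hy.2⟩)
    linarith
  · have h4 : 0 < ∫ t in s..y, - g t :=
      intervalIntegral.intervalIntegral_pos_of_pos_on (hint s hs.1 y hyT).neg
        (fun u hu => neg_pos.2 (hneg u ⟨hu.1.le, hu.2.le.trans h.le⟩)) hy.1
    rw [intervalIntegral.integral_neg] at h4
    linarith [hsub s hs.1 y hyT]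

/-- A maximum at the left end of an interval forces a nonpositive derivative. -/
theorem HasDerivAt.nonpos_of_le_right {f : ℝ → ℝ} {f' : ℝ} (hf : HasDerivAt f f' 0)
    (hmax : ∀ ε ∈ Icc (0 : ℝ) 1, f ε ≤ f 0) : f' ≤ 0 := by
  have h := (hasDerivWithinAt_iff_tendsto_slope' (s := Ioi 0) (by simp)).1
    (hf.hasDerivWithinAt (s := Ioi 0))
  refine le_of_tendsto h ?_
  filter_upwards [Ioc_mem_nhdsGT (zero_lt_one (α := ℝ))] with ε hε
  rw [slope_def_field]
  exact div_nonpos_of_nonpos_of_nonneg (by linarith [hmax ε ⟨hε.1.le, hε.2⟩]) (by linarith [hε.1])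

/-! ### Policies and their paths of past effort -/

noncomputable section
namespace DoThinkProblem

variable {M : DoThinkProblem} {a b : ℝ → ℝ}

theorem IsPolicy.integrableOn (h : M.IsPolicy a) : IntegrableOn a (Icc 0 M.T) := by
  refine Integrable.of_bound h.1.aestronglyMeasurable 1 ?_
  rw [ae_restrict_iff' measurableSet_Icc]
  refine .of_forall fun t ht => ?_
  have := h.2 t ht
  rw [Real.norm_eq_abs, abs_le]
  constructor <;> linarith [this.1, this.2]

theorem IsPolicy.intervalIntegrable (h : M.IsPolicy a) {x y : ℝ} (hx : x ∈ Icc 0 M.T)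
    (hy : y ∈ Icc 0 M.T) : IntervalIntegrable a volume x y :=
  (h.integrableOn.mono_set (uIcc_subset_Icc hx hy)).intervalIntegrable

@[simp] theorem pastEffort_T : M.pastEffort a M.T = 0 := intervalIntegral.integral_same

theorem IsPolicy.pastEffort_sub (h : M.IsPolicy a) {x y : ℝ} (hx : x ∈ Icc 0 M.T)
    (hy : y ∈ Icc 0 M.T) : M.pastEffort a x - M.pastEffort a y = ∫ t in x..y, a t := by
  have hT : M.T ∈ Icc 0 M.T := ⟨hx.1.trans hx.2, le_rfl⟩
  rw [pastEffort, pastEffort, sub_eq_iff_eq_add, intervalIntegral.integral_add_adjacent_intervals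
    (h.intervalIntegrable hx hy) (h.intervalIntegrable hy hT)]

theorem IsPolicy.pastEffort_sub_mem (h : M.IsPolicy a) {x y : ℝ} (hx : x ∈ Icc 0 M.T)
    (hy : y ∈ Icc 0 M.T) (hxy : x ≤ y) :
    M.pastEffort a x - M.pastEffort a y ∈ Icc 0 (y - x) := by
  rw [h.pastEffort_sub hx hy]
  have hmem : ∀ t ∈ Icc x y, a t ∈ Icc (0 : ℝ) 1 := fun t ht =>
    h.2 t ⟨hx.1.trans ht.1, ht.2.trans hy.2⟩
  refine ⟨intervalIntegral.integral_nonneg hxy fun t ht => (hmem t ht).1, ?_⟩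
  have := intervalIntegral.integral_mono_on hxy (h.intervalIntegrable hx hy)
    (intervalIntegrable_const (c := (1 : ℝ))) fun t ht => (hmem t ht).2
  simpa using this

theorem IsPolicy.pastEffort_nonneg (h : M.IsPolicy a) {x : ℝ} (hx : x ∈ Icc 0 M.T) :
    0 ≤ M.pastEffort a x := by
  have := (h.pastEffort_sub_mem hx ⟨hx.1.trans hx.2, le_rfl⟩ hx.2).1
  simpa using this

theorem IsPolicy.pastEffort_mem (h : M.IsPolicy a) {x : ℝ} (hx : x ∈ Icc 0 M.T) :
    M.pastEffort a x ∈ Icc 0 M.T := by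
  have := (h.pastEffort_sub_mem hx ⟨hx.1.trans hx.2, le_rfl⟩ hx.2)
  rw [pastEffort_T, sub_zero] at this
  exact ⟨this.1, this.2.trans (by linarith [hx.1])⟩

theorem IsPolicy.pastEffort_antitoneOn (h : M.IsPolicy a) :
    AntitoneOn (M.pastEffort a) (Icc 0 M.T) := fun x hx y hy hxy => by
  linarith [(h.pastEffort_sub_mem hx hy hxy).1]

theorem pastEffort_eq_neg : M.pastEffort a = -fun τ => ∫ s in M.T..τ, a s :=
  funext fun τ => intervalIntegral.integral_symm M.T τ

/-- Integrals over `τ..T` are absolutely continuous in `τ`. -/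
theorem absolutelyContinuous_pastEffort
    (h : IntervalIntegrable a volume 0 M.T) :
    AbsolutelyContinuousOnInterval (M.pastEffort a) 0 M.T := by
  have := (h.absolutelyContinuousOnInterval_intervalIntegral (c := M.T) right_mem_uIcc).neg
  rwa [← pastEffort_eq_neg] at this

theorem ae_hasDerivAt_pastEffort (h : IntervalIntegrable a volume 0 M.T) :
    ∀ᵐ τ, τ ∈ uIcc 0 M.T → HasDerivAt (M.pastEffort a) (- a τ) τ := by
  filter_upwards [h.ae_hasDerivAt_integral] with τ hτ hmem
  have := (hτ hmem M.T right_mem_uIcc).neg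
  rwa [← pastEffort_eq_neg] at this

theorem IsPolicy.continuousOn_pastEffort (hT : 0 ≤ M.T) (h : M.IsPolicy a) :
    ContinuousOn (M.pastEffort a) (Icc 0 M.T) := by
  have := (absolutelyContinuous_pastEffort
    (h.intervalIntegrable ⟨le_rfl, hT⟩ ⟨hT, le_rfl⟩)).continuousOn
  rwa [uIcc_of_le hT] at this

theorem IsPolicy.lipschitzOnWith_pastEffort (h : M.IsPolicy a) :
    LipschitzOnWith 1 (M.pastEffort a) (Icc 0 M.T) := by
  refine LipschitzOnWith.of_le_add fun x hx y hy => ?_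
  rw [Real.dist_eq]
  rcases le_total x y with hxy | hxy
  · rw [abs_sub_comm, abs_of_nonneg (sub_nonneg.2 hxy)]
    linarith [(h.pastEffort_sub_mem hx hy hxy).2]
  · have := h.pastEffort_antitoneOn hy hx hxy
    linarith [abs_nonneg (x - y)]

/-- Integration by parts along a path of past effort. -/
theorem IsPolicy.integral_mul_comp_pastEffort (hT : 0 ≤ M.T) (h : M.IsPolicy a)
    {f F g g' : ℝ → ℝ} (hf : Continuous f) (hF : ∀ x, HasDerivAt F (f x) x) (hF0 : F 0 = 0)
    (hg : AbsolutelyContinuousOnInterval g 0 M.T) (hg' : ∀ τ ∈ Ioc 0 M.T, HasDerivAt g (g' τ) τ) :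
    ∫ τ in (0 : ℝ)..M.T, g τ * (a τ * f (M.pastEffort a τ)) =
      g 0 * F (M.pastEffort a 0) + ∫ τ in (0 : ℝ)..M.T, g' τ * F (M.pastEffort a τ) := by
  have hi := h.intervalIntegrable (x := 0) (y := M.T) ⟨le_rfl, hT⟩ ⟨hT, le_rfl⟩
  have hFd : ContDiff ℝ 1 F := by
    rw [contDiff_one_iff_deriv]
    refine ⟨fun x => (hF x).differentiableAt, ?_⟩
    rwa [show deriv F = f from funext fun x => (hF x).deriv]
  obtain ⟨K, hK⟩ := hFd.contDiffOn.exists_lipschitzOnWith (by decide)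
    (convex_Icc 0 M.T) isCompact_Icc
  -- Past effort is 1-Lipschitz with values in `[0, T]`, where `F` is Lipschitz.
  have hac : AbsolutelyContinuousOnInterval (F ∘ M.pastEffort a) 0 M.T := by
    apply LipschitzOnWith.absolutelyContinuousOnInterval (K := K * 1)
    rw [uIcc_of_le hT]
    exact hK.comp h.lipschitzOnWith_pastEffort fun x hx => h.pastEffort_mem hx
  have key := hg.integral_mul_deriv_eq_deriv_mul hac
  have e1 : ∫ τ in (0 : ℝ)..M.T, g τ * deriv (F ∘ M.pastEffort a) τ =
      - ∫ τ in (0 : ℝ)..M.T, g τ * (a τ * f (M.pastEffort a τ)) := by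
    rw [← intervalIntegral.integral_neg]
    apply intervalIntegral.integral_congr_ae
    filter_upwards [ae_hasDerivAt_pastEffort hi] with τ hτ hmem
    rw [((hF _).comp τ (hτ (uIoc_subset_uIcc hmem))).deriv]
    ring
  have e2 : ∫ τ in (0 : ℝ)..M.T, deriv g τ * (F ∘ M.pastEffort a) τ =
      ∫ τ in (0 : ℝ)..M.T, g' τ * F (M.pastEffort a τ) := by
    apply intervalIntegral.integral_congr_ae
    refine .of_forall fun τ hmem => ?_
    rw [uIoc_of_le hT] at hmem
    rw [(hg' τ hmem).deriv, Function.comp]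
  -- The boundary term at `T` vanishes: no effort has been spent yet, and `F 0 = 0`.
  rw [e1, e2] at key
  simp only [Function.comp, pastEffort_T, hF0] at key
  linarith

/-! ### Standing assumptions and monotonicity of the advantage -/

/-- The standing assumptions. -/
structure Standing (M : DoThinkProblem) : Prop where
  T_pos : 0 < M.T
  c_pos : 0 < M.c
  lam_pos : 0 < M.lam
  mu_pos : 0 < M.mu
  B_pos : 0 < M.B
  pbar_pos : 0 < M.pbar
  pbar_lt : M.pbar < 1
  contDiffOn : ContDiffOn ℝ 3 M.V (Ici 0)
  V_zero : M.V 0 = 0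
  deriv_pos : ∀ τ ∈ Ici (0 : ℝ), 0 < derivWithin M.V (Ici 0) τ
  curvature : ∀ τ ∈ Ici (0 : ℝ), M.pbar * M.lam ≤
    -derivWithin (derivWithin M.V (Ici 0)) (Ici 0) τ / derivWithin M.V (Ici 0) τ

/-- The value of progress, extended by a constant to negative times. -/
def val (M : DoThinkProblem) (τ : ℝ) : ℝ := M.V (max τ 0)

/-- The marginal value of time after progress, extended by a constant to negative times. -/
def marg (M : DoThinkProblem) (τ : ℝ) : ℝ := derivWithin M.V (Ici 0) (max τ 0)

variable (hM : M.Standing)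
include hM

theorem Standing.continuous_val : Continuous M.val :=
  hM.contDiffOn.continuousOn.comp_continuous (by fun_prop) fun τ => le_max_right τ 0

theorem Standing.contDiffOn_derivWithin : ContDiffOn ℝ 2 (derivWithin M.V (Ici 0)) (Ici 0) :=
  hM.contDiffOn.derivWithin (uniqueDiffOn_Ici 0) (by norm_num)

theorem Standing.continuous_marg : Continuous M.marg :=
  hM.contDiffOn_derivWithin.continuousOn.comp_continuous (by fun_prop) fun τ => le_max_right τ 0

theorem Standing.marg_pos (τ : ℝ) : 0 < M.marg τ := hM.deriv_pos _ (le_max_right τ 0)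

theorem Standing.hasDerivAt_val {τ : ℝ} (hτ : 0 < τ) : HasDerivAt M.val (M.marg τ) τ := by
  have h := ((hM.contDiffOn.differentiableOn (by norm_num)) τ hτ.le).hasDerivWithinAt.hasDerivAt
    (Ici_mem_nhds hτ)
  rw [marg, max_eq_left hτ.le]
  refine h.congr_of_eventuallyEq ?_
  filter_upwards [Ioi_mem_nhds hτ] with t ht
  rw [val, max_eq_left (le_of_lt ht)]

theorem Standing.hasDerivAt_marg {τ : ℝ} (hτ : 0 < τ) :
    HasDerivAt M.marg (derivWithin (derivWithin M.V (Ici 0)) (Ici 0) τ) τ := by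
  have h := ((hM.contDiffOn_derivWithin.differentiableOn (by norm_num)) τ
    hτ.le).hasDerivWithinAt.hasDerivAt (Ici_mem_nhds hτ)
  refine h.congr_of_eventuallyEq ?_
  filter_upwards [Ioi_mem_nhds hτ] with t ht
  rw [marg, max_eq_left (le_of_lt ht)]

omit hM in
/-- The advantage of postponing thinking when the hazard rate of a solution is `π`. -/
def advantage (M : DoThinkProblem) (π τ : ℝ) : ℝ :=
  π * (M.c + M.mu * (M.B - M.val τ)) - M.mu * (M.c + M.marg τ)

theorem Standing.hasDerivAt_advantage (π : ℝ) {τ : ℝ} (hτ : 0 < τ) :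
    HasDerivAt (M.advantage π)
      (M.mu * M.marg τ *
        (-derivWithin (derivWithin M.V (Ici 0)) (Ici 0) τ / derivWithin M.V (Ici 0) τ - π)) τ := by
  have h := (((((hM.hasDerivAt_val hτ).const_sub M.B).const_mul M.mu).const_add M.c).const_mul
    π).sub (((hM.hasDerivAt_marg hτ).const_add M.c).const_mul M.mu)
  have hne : derivWithin M.V (Ici 0) τ ≠ 0 := (hM.deriv_pos τ hτ.le).ne'
  refine HasDerivAt.congr_deriv (f := M.advantage π) h ?_
  rw [show M.marg τ = derivWithin M.V (Ici 0) τ by rw [marg, max_eq_left hτ.le]]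
  field_simp
  ring

theorem Standing.continuous_advantage (π : ℝ) : Continuous (M.advantage π) := by
  have := hM.continuous_val
  have := hM.continuous_marg
  unfold advantage
  fun_prop

/-- The derivative has the sign of `-V'' / V' - π`. The curvature bound therefore covers exactly the
hazard rates up to the initial one, `λ p̄`, which are all those met along a path. -/
theorem Standing.advantage_mono {π : ℝ} (hπ : π ≤ M.lam * M.pbar) :
    MonotoneOn (M.advantage π) (Ici 0) := by
  apply monotoneOn_of_deriv_nonneg (convex_Ici 0) (hM.continuous_advantage π).continuousOn
  · intro τ hτ
    rw [interior_Ici] at hτ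
    exact (hM.hasDerivAt_advantage π hτ).differentiableAt.differentiableWithinAt
  · intro τ hτ
    rw [interior_Ici] at hτ
    rw [(hM.hasDerivAt_advantage π hτ).deriv]
    have := hM.curvature τ (mem_Ici.2 (le_of_lt hτ))
    exact mul_nonneg (mul_pos hM.mu_pos (hM.marg_pos τ)).le (by linarith)

theorem Standing.advantage_strictMono {π : ℝ} (hπ : π < M.lam * M.pbar) :
    StrictMonoOn (M.advantage π) (Ici 0) := by
  apply strictMonoOn_of_deriv_pos (convex_Ici 0) (hM.continuous_advantage π).continuousOn
  intro τ hτ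
  rw [interior_Ici] at hτ
  rw [(hM.hasDerivAt_advantage π hτ).deriv]
  have := hM.curvature τ (mem_Ici.2 (le_of_lt hτ))
  exact mul_pos (mul_pos hM.mu_pos (hM.marg_pos τ)) (by linarith)

/-- Nonnegative advantage means that `π` times this coefficient is at least `μ (c + V')`, which is
positive. This makes the advantage increasing in the hazard rate. -/
theorem Standing.coeff_pos {π τ : ℝ} (hπ : 0 < π) (h : 0 ≤ M.advantage π τ) :
    0 < M.c + M.mu * (M.B - M.val τ) := by
  have h1 : 0 < M.mu * (M.c + M.marg τ) := mul_pos hM.mu_pos (by linarith [hM.c_pos, hM.marg_pos τ])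
  unfold advantage at h
  exact pos_of_mul_pos_right (by linarith : 0 < π * _) hπ.le

omit hM in
/-- The probability of no solution, scaled by `exp (mu x)`. -/
def scaledSurvival (M : DoThinkProblem) (x : ℝ) : ℝ :=
  (1 - M.pbar) * Real.exp (M.mu * x) + M.pbar * Real.exp ((M.mu - M.lam) * x)

omit hM in
/-- The density of a solution per unit of doing effort, scaled by `exp (mu x)`. -/
def scaledRate (M : DoThinkProblem) (x : ℝ) : ℝ :=
  M.lam * M.pbar * Real.exp ((M.mu - M.lam) * x)

omit hM in
/-- The hazard rate of a solution per unit of doing effort. -/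
def hazard (M : DoThinkProblem) (x : ℝ) : ℝ := M.scaledRate x / M.scaledSurvival x

theorem Standing.scaledSurvival_pos (x : ℝ) : 0 < M.scaledSurvival x := by
  have := hM.pbar_pos
  have : 0 < 1 - M.pbar := by linarith [hM.pbar_lt]
  unfold scaledSurvival
  positivity

theorem Standing.scaledRate_pos (x : ℝ) : 0 < M.scaledRate x := by
  have := hM.pbar_pos
  have := hM.lam_pos
  unfold scaledRate
  positivity

theorem Standing.hazard_pos (x : ℝ) : 0 < M.hazard x :=
  div_pos (hM.scaledRate_pos x) (hM.scaledSurvival_pos x)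

/-- Effort without a solution is bad news about the arm. Cancelling `exp ((μ - λ) x)` leaves `x`
only in an increasing denominator. -/
theorem Standing.hazard_strictAnti : StrictAnti M.hazard := by
  have h : ∀ x, M.hazard x =
      M.lam * M.pbar / ((1 - M.pbar) * Real.exp (M.lam * x) + M.pbar) := by
    intro x
    have h1 := hM.scaledSurvival_pos x
    have hp := hM.pbar_pos
    have h2 : 0 < (1 - M.pbar) * Real.exp (M.lam * x) + M.pbar := by
      have : 0 < 1 - M.pbar := by linarith [hM.pbar_lt]
      positivity
    rw [hazard, div_eq_div_iff h1.ne' h2.ne', scaledRate, scaledSurvival]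
    have : Real.exp (M.mu * x) = Real.exp ((M.mu - M.lam) * x) * Real.exp (M.lam * x) := by
      rw [← Real.exp_add]; ring_nf
    rw [this]; ring
  intro x y hxy
  rw [h, h]
  have hp := hM.pbar_pos
  have h1p : 0 < 1 - M.pbar := by linarith [hM.pbar_lt]
  have := hM.lam_pos
  gcongr

omit hM in
theorem hazard_zero : M.hazard 0 = M.lam * M.pbar := by
  simp [hazard, scaledRate, scaledSurvival]

omit hM in
theorem continuous_scaledSurvival : Continuous M.scaledSurvival := by
  unfold scaledSurvival; fun_prop

omit hM in
theorem continuous_scaledRate : Continuous M.scaledRate := by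
  unfold scaledRate; fun_prop

omit hM in
theorem hasDerivAt_scaledSurvival (x : ℝ) :
    HasDerivAt M.scaledSurvival (M.mu * M.scaledSurvival x - M.scaledRate x) x := by
  have h1 := ((((hasDerivAt_id x).const_mul M.mu).exp).const_mul (1 - M.pbar)).add
    ((((hasDerivAt_id x).const_mul (M.mu - M.lam)).exp).const_mul M.pbar)
  refine HasDerivAt.congr_deriv (f := M.scaledSurvival) h1 ?_
  simp only [scaledSurvival, scaledRate, id]
  ring

/-- Along a path of past effort the advantage of postponing thinking is increasing once it is
nonnegative. -/
theorem Standing.advantage_le_of_nonneg {x y A A' : ℝ} (hx : 0 ≤ x) (hxy : x ≤ y) (hA' : 0 ≤ A')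
    (hA : A' ≤ A) (h : 0 ≤ M.advantage (M.hazard A) x) :
    M.advantage (M.hazard A) x ≤ M.advantage (M.hazard A') y := by
  have h1 := (hM.coeff_pos (hM.hazard_pos A) h).le
  have h2 := hM.hazard_strictAnti.antitone hA
  have h3 : M.hazard A' ≤ M.lam * M.pbar := by
    rw [← hazard_zero]; exact hM.hazard_strictAnti.antitone hA'
  calc M.advantage (M.hazard A) x ≤ M.advantage (M.hazard A') x := by
        unfold advantage; gcongr
    _ ≤ _ := hM.advantage_mono h3 hx (hx.trans hxy) hxy

/-- The advantage can stay at zero only as long as there has been no effort on the doing arm. -/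
theorem Standing.eq_zero_of_advantage_eq_zero {x y A A' : ℝ} (hx : 0 ≤ x) (hxy : x < y)
    (hA' : 0 ≤ A') (hA : A' ≤ A) (h : M.advantage (M.hazard A) x = 0)
    (h' : M.advantage (M.hazard A') y = 0) : A = 0 := by
  have h1 := hM.coeff_pos (hM.hazard_pos A) h.ge
  have hAA : A' = A := by
    by_contra hne
    have h2 := hM.hazard_strictAnti (lt_of_le_of_ne hA hne)
    have h3 : M.hazard A' ≤ M.lam * M.pbar := by
      rw [← hazard_zero]; exact hM.hazard_strictAnti.antitone hA'
    have h4 : M.advantage (M.hazard A) x < M.advantage (M.hazard A') x := by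
      unfold advantage; gcongr
    linarith [hM.advantage_mono h3 hx (hx.trans hxy.le) hxy.le]
  subst hAA
  by_contra hne
  have h3 : M.hazard A' < M.lam * M.pbar := by
    rw [← hazard_zero]; exact hM.hazard_strictAnti (lt_of_le_of_ne hA' (Ne.symm hne))
  linarith [hM.advantage_strictMono h3 hx (hx.trans hxy.le) hxy]

end DoThinkProblem
end

/-! ### The payoff as a functional of the path of past effort -/

noncomputable section
namespace DoThinkProblem

variable {M : DoThinkProblem} {a b : ℝ → ℝ}

/-- Probability of no progress with time `τ` remaining under thinking throughout. -/
def discount (M : DoThinkProblem) (τ : ℝ) : ℝ := Real.exp (-M.mu * (M.T - τ))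

/-- Based at `0`, the value of past effort at `τ = T`, so that integration by parts leaves no
boundary term there. -/
def survivalPrimitive (M : DoThinkProblem) (x : ℝ) : ℝ := ∫ y in (0 : ℝ)..x, M.scaledSurvival y

def ratePrimitive (M : DoThinkProblem) (x : ℝ) : ℝ := ∫ y in (0 : ℝ)..x, M.scaledRate y

/-- The flow payoff after integration by parts: it depends on past effort alone. -/
def reducedFlow (M : DoThinkProblem) (τ x : ℝ) : ℝ :=
  M.discount τ * ((M.mu * M.val τ - M.c) * M.scaledSurvival x +
    M.mu * M.B * M.ratePrimitive x - M.mu * (M.mu * M.val τ + M.marg τ) * M.survivalPrimitive x)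

/-- The payoff as a functional of the path of past effort. -/
def reducedPayoff (M : DoThinkProblem) (x : ℝ → ℝ) : ℝ :=
  M.discount 0 * M.B * M.ratePrimitive (x 0) + ∫ τ in (0 : ℝ)..M.T, M.reducedFlow τ (x τ)

/-- The derivative of the reduced flow payoff in past effort. -/
def marginalFlow (M : DoThinkProblem) (τ x : ℝ) : ℝ :=
  M.discount τ * M.scaledSurvival x * M.advantage (M.hazard x) τ

/-- The switching function along a path of past effort. -/
def switching (M : DoThinkProblem) (x : ℝ → ℝ) (s : ℝ) : ℝ :=
  M.discount 0 * M.B * M.scaledRate (x 0) + ∫ τ in (0 : ℝ)..s, M.marginalFlow τ (x τ)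

theorem hasDerivAt_discount (τ : ℝ) : HasDerivAt M.discount (M.mu * M.discount τ) τ := by
  have h := (((hasDerivAt_id τ).const_sub M.T).const_mul (-M.mu)).exp
  refine HasDerivAt.congr_deriv (f := M.discount) h ?_
  simp only [discount, id]
  ring

theorem continuous_discount : Continuous M.discount := by unfold discount; fun_prop

theorem discount_pos (τ : ℝ) : 0 < M.discount τ := Real.exp_pos _

theorem hasDerivAt_survivalPrimitive (x : ℝ) :
    HasDerivAt M.survivalPrimitive (M.scaledSurvival x) x :=
  continuous_scaledSurvival.integral_hasStrictDerivAt 0 x |>.hasDerivAt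

theorem hasDerivAt_ratePrimitive (x : ℝ) : HasDerivAt M.ratePrimitive (M.scaledRate x) x :=
  continuous_scaledRate.integral_hasStrictDerivAt 0 x |>.hasDerivAt

theorem continuous_survivalPrimitive : Continuous M.survivalPrimitive :=
  continuous_iff_continuousAt.2 fun x => (hasDerivAt_survivalPrimitive x).continuousAt

theorem continuous_ratePrimitive : Continuous M.ratePrimitive :=
  continuous_iff_continuousAt.2 fun x => (hasDerivAt_ratePrimitive x).continuousAt

theorem Standing.continuous_reducedFlow (hM : M.Standing) :
    Continuous fun z : ℝ × ℝ => M.reducedFlow z.1 z.2 := by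
  have := hM.continuous_val
  have := hM.continuous_marg
  have := continuous_discount (M := M)
  have := continuous_scaledSurvival (M := M)
  have := continuous_survivalPrimitive (M := M)
  have := continuous_ratePrimitive (M := M)
  unfold reducedFlow
  fun_prop

theorem Standing.continuous_hazard (hM : M.Standing) : Continuous M.hazard :=
  continuous_scaledRate.div continuous_scaledSurvival fun x => (hM.scaledSurvival_pos x).ne'

theorem Standing.continuous_marginalFlow (hM : M.Standing) :
    Continuous fun z : ℝ × ℝ => M.marginalFlow z.1 z.2 := by
  have := hM.continuous_val
  have := hM.continuous_marg
  have := continuous_discount (M := M)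
  have := continuous_scaledSurvival (M := M)
  have := hM.continuous_hazard
  unfold marginalFlow advantage
  fun_prop

/-- Because the scaled survival `S` and rate `R` satisfy `S' = μ S - R`, the terms in `μ² V S`
cancel and `R (c + μ (B - V)) - μ (c + V') S` remains. -/
theorem Standing.hasDerivAt_reducedFlow (hM : M.Standing) (τ x : ℝ) :
    HasDerivAt (M.reducedFlow τ) (M.marginalFlow τ x) x := by
  have h := ((((hasDerivAt_scaledSurvival (M := M) x).const_mul (M.mu * M.val τ - M.c)).add
    ((hasDerivAt_ratePrimitive (M := M) x).const_mul (M.mu * M.B))).sub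
    ((hasDerivAt_survivalPrimitive (M := M) x).const_mul
      (M.mu * (M.mu * M.val τ + M.marg τ)))).const_mul (M.discount τ)
  refine HasDerivAt.congr_deriv (f := M.reducedFlow τ) h ?_
  have := (hM.scaledSurvival_pos x).ne'
  simp only [marginalFlow, advantage, hazard]
  field_simp
  ring

/-- The denominator of the belief is the probability of no solution, so their product is elementary
and the integrand is affine in the share `x`. -/
theorem Standing.payoff_integrand (hM : M.Standing) {τ : ℝ} (hτ : 0 ≤ τ) (x A : ℝ) :
    M.probNoProgress τ A * M.probNoSolution A * M.flowPayoff x A τ =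
      M.discount τ * ((M.mu * M.val τ - M.c) * M.scaledSurvival A) +
      (M.discount τ * M.B * (x * M.scaledRate A) -
        M.mu * M.discount τ * M.val τ * (x * M.scaledSurvival A)) := by
  have e1 : M.probNoProgress τ A = M.discount τ * Real.exp (M.mu * A) := by
    rw [probNoProgress, discount, ← Real.exp_add]; ring_nf
  have e2 : Real.exp (M.mu * A) * M.probNoSolution A = M.scaledSurvival A := by
    rw [probNoSolution, scaledSurvival, show (M.mu - M.lam) * A = M.mu * A + -M.lam * A by ring,
      Real.exp_add]
    ring
  have hpos : 0 < M.pbar * Real.exp (-M.lam * A) + (1 - M.pbar) := by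
    have := hM.pbar_pos
    have : 0 < 1 - M.pbar := by linarith [hM.pbar_lt]
    positivity
  have e3 : M.lam * (M.scaledSurvival A * M.belief A) = M.scaledRate A := by
    rw [← e2, belief, probNoSolution, scaledRate,
      show (M.mu - M.lam) * A = M.mu * A + -M.lam * A by ring, Real.exp_add,
      add_comm (1 - M.pbar), mul_assoc (Real.exp (M.mu * A)), mul_div_cancel₀ _ hpos.ne']
    ring
  have e4 : M.V τ = M.val τ := by rw [val, max_eq_left hτ]
  rw [flowPayoff, e1, e4, ← e3, mul_assoc (M.discount τ), e2]
  ring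

/-- Integrability of the product of a policy with a continuous function of time and past
effort. -/
theorem IsPolicy.intervalIntegrable_mul (hT : 0 ≤ M.T) (h : M.IsPolicy a) {f g : ℝ → ℝ}
    (hf : Continuous f) (hg : Continuous g) :
    IntervalIntegrable (fun τ => g τ * (a τ * f (M.pastEffort a τ))) volume 0 M.T := by
  have hi := h.intervalIntegrable (x := 0) (y := M.T) ⟨le_rfl, hT⟩ ⟨hT, le_rfl⟩
  have hA := h.continuousOn_pastEffort hT
  rw [← uIcc_of_le hT] at hA
  exact (hi.mul_continuousOn (hf.comp_continuousOn hA)).continuousOn_mul hg.continuousOn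

theorem Standing.absolutelyContinuous_val (hM : M.Standing) :
    AbsolutelyContinuousOnInterval M.val 0 M.T := by
  have h : ContDiffOn ℝ 1 M.val (uIcc 0 M.T) := by
    rw [uIcc_of_le hM.T_pos.le]
    refine ((hM.contDiffOn.of_le (by norm_num)).mono Icc_subset_Ici_self).congr fun τ hτ => ?_
    rw [val, max_eq_left hτ.1]
  exact h.absolutelyContinuousOnInterval

theorem absolutelyContinuous_discount : AbsolutelyContinuousOnInterval M.discount 0 M.T := by
  have h : ContDiff ℝ 1 M.discount := by unfold discount; fun_prop
  exact h.contDiffOn.absolutelyContinuousOnInterval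

theorem Standing.continuousOn_comp (hM : M.Standing) {F : ℝ × ℝ → ℝ} (hF : Continuous F)
    (h : M.IsPolicy a) : ContinuousOn (fun τ => F (τ, M.pastEffort a τ)) (Icc 0 M.T) :=
  hF.comp_continuousOn (continuousOn_id.prodMk (h.continuousOn_pastEffort hM.T_pos.le))

theorem Standing.payoff_eq (hM : M.Standing) (h : M.IsPolicy a) :
    M.payoff a = M.reducedPayoff (M.pastEffort a) := by
  have hT := hM.T_pos.le
  have cv := hM.continuous_val
  have cm := hM.continuous_marg
  have cd := continuous_discount (M := M)
  have cs := continuous_scaledSurvival (M := M)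
  have cr := continuous_scaledRate (M := M)
  have csp := continuous_survivalPrimitive (M := M)
  have crp := continuous_ratePrimitive (M := M)
  have e0 : M.payoff a = ∫ τ in (0 : ℝ)..M.T,
      (M.discount τ * ((M.mu * M.val τ - M.c) * M.scaledSurvival (M.pastEffort a τ)) +
      (M.discount τ * M.B * (a τ * M.scaledRate (M.pastEffort a τ)) -
        M.mu * M.discount τ * M.val τ * (a τ * M.scaledSurvival (M.pastEffort a τ)))) := by
    apply intervalIntegral.integral_congr
    intro τ hτ
    rw [uIcc_of_le hT] at hτ
    exact hM.payoff_integrand hτ.1 _ _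
  have hint : ∀ F : ℝ × ℝ → ℝ, Continuous F →
      IntervalIntegrable (fun τ => F (τ, M.pastEffort a τ)) volume 0 M.T := by
    intro F hF
    apply ContinuousOn.intervalIntegrable
    rw [uIcc_of_le hT]
    exact hM.continuousOn_comp hF h
  have i1 := hint (fun z => M.discount z.1 * ((M.mu * M.val z.1 - M.c) * M.scaledSurvival z.2))
    (by fun_prop)
  have i2 := h.intervalIntegrable_mul hT cr (g := fun τ => M.discount τ * M.B) (by fun_prop)
  have i3 := h.intervalIntegrable_mul hT cs (g := fun τ => M.mu * M.discount τ * M.val τ)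
    (by fun_prop)
  have p2 := h.integral_mul_comp_pastEffort hT cr hasDerivAt_ratePrimitive
    (by simp [ratePrimitive]) (g := fun τ => M.discount τ * M.B)
    (g' := fun τ => M.mu * M.discount τ * M.B)
    (by simpa only [mul_comm _ M.B] using absolutelyContinuous_discount.const_mul M.B)
    (fun τ _ => (hasDerivAt_discount τ).mul_const M.B)
  have p3 := h.integral_mul_comp_pastEffort hT cs hasDerivAt_survivalPrimitive
    (by simp [survivalPrimitive]) (g := fun τ => M.mu * M.discount τ * M.val τ)
    (g' := fun τ => M.mu * (M.mu * M.discount τ) * M.val τ + M.mu * M.discount τ * M.marg τ)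
    ((absolutelyContinuous_discount.const_mul M.mu).mul hM.absolutelyContinuous_val)
    (fun τ hτ => ((hasDerivAt_discount τ).const_mul M.mu).mul (hM.hasDerivAt_val hτ.1))
  -- Progress at the deadline is worth nothing, so of the two boundary terms at `τ = 0` only the one
  -- with `B` survives.
  have hv0 : M.val 0 = 0 := by simp [val, hM.V_zero]
  have j2 := hint (fun z => M.mu * M.discount z.1 * M.B * M.ratePrimitive z.2) (by fun_prop)
  have j3 := hint (fun z => (M.mu * (M.mu * M.discount z.1) * M.val z.1 +
    M.mu * M.discount z.1 * M.marg z.1) * M.survivalPrimitive z.2) (by fun_prop)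
  rw [e0, intervalIntegral.integral_add i1 (i2.sub i3), intervalIntegral.integral_sub i2 i3, p2, p3,
    hv0, mul_zero, zero_mul, zero_add, add_sub_assoc, add_left_comm,
    ← intervalIntegral.integral_sub j2 j3, ← intervalIntegral.integral_add i1 (j2.sub j3),
    reducedPayoff]
  congr 1
  apply intervalIntegral.integral_congr
  intro τ _
  simp only [reducedFlow]
  ring

/-! ### First variation and bang-bang control -/

/-- The first variation of the payoff, written with the switching function. -/
theorem Standing.first_variation (hM : M.Standing) (h : M.IsPolicy a) (hb : M.IsPolicy b) :
    HasDerivAt (fun ε => M.reducedPayoff fun τ =>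
        M.pastEffort a τ + ε * (M.pastEffort b τ - M.pastEffort a τ))
      (∫ τ in (0 : ℝ)..M.T, (b τ - a τ) * M.switching (M.pastEffort a) τ) 0 := by
  have hT := hM.T_pos.le
  have ia := h.intervalIntegrable (x := 0) (y := M.T) ⟨le_rfl, hT⟩ ⟨hT, le_rfl⟩
  have ib := hb.intervalIntegrable (x := 0) (y := M.T) ⟨le_rfl, hT⟩ ⟨hT, le_rfl⟩
  have cA := h.continuousOn_pastEffort hT
  have cB := hb.continuousOn_pastEffort hT
  set A := M.pastEffort a
  set H : ℝ → ℝ := fun τ => M.pastEffort b τ - A τ with hH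
  have cH : ContinuousOn H (Icc 0 M.T) := cB.sub cA
  have cF := hM.continuous_reducedFlow
  have cG := hM.continuous_marginalFlow
  have cjoint : ContinuousOn (fun z : ℝ × ℝ => M.marginalFlow z.2 (A z.2 + z.1 * H z.2) * H z.2)
      (Icc (-1) 1 ×ˢ Icc 0 M.T) := by
    have c2 : ContinuousOn (fun z : ℝ × ℝ => A z.2) (Icc (-1) 1 ×ˢ Icc 0 M.T) :=
      cA.comp continuousOn_snd fun z hz => hz.2
    have c3 : ContinuousOn (fun z : ℝ × ℝ => H z.2) (Icc (-1) 1 ×ˢ Icc 0 M.T) :=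
      cH.comp continuousOn_snd fun z hz => hz.2
    exact (cG.comp_continuousOn (continuousOn_snd.prodMk (c2.add (continuousOn_fst.mul c3)))).mul c3
  -- A constant dominating the `ε`-derivative for `|ε| ≤ 1`, for differentiation under the integral
  -- sign.
  obtain ⟨C, hC⟩ := (isCompact_Icc.prod isCompact_Icc).exists_bound_of_continuousOn cjoint
  have cFε : ∀ ε, ContinuousOn (fun τ => M.reducedFlow τ (A τ + ε * H τ)) (uIcc 0 M.T) := by
    intro ε
    rw [uIcc_of_le hT]
    exact cF.comp_continuousOn (continuousOn_id.prodMk (cA.add (continuousOn_const.mul cH)))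
  have cG0 : ContinuousOn (fun τ => M.marginalFlow τ (A τ)) (Icc 0 M.T) :=
    cG.comp_continuousOn (continuousOn_id.prodMk cA)
  have hlin : ∀ τ ε, HasDerivAt (fun ε => A τ + ε * H τ) (H τ) ε := fun τ ε => by
    simpa using ((hasDerivAt_id ε).mul_const (H τ)).const_add (A τ)
  have d1 : HasDerivAt (fun ε => ∫ τ in (0 : ℝ)..M.T, M.reducedFlow τ (A τ + ε * H τ))
      (∫ τ in (0 : ℝ)..M.T, M.marginalFlow τ (A τ + 0 * H τ) * H τ) 0 := by
    refine (intervalIntegral.hasDerivAt_integral_of_dominated_loc_of_deriv_le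
      (F := fun ε τ => M.reducedFlow τ (A τ + ε * H τ))
      (F' := fun ε τ => M.marginalFlow τ (A τ + ε * H τ) * H τ)
      (s := Icc (-1) 1) (bound := fun _ => C)
      (Icc_mem_nhds (by norm_num) (by norm_num)) (.of_forall fun ε => ?_)
      (cFε 0).intervalIntegrable ?_ (.of_forall fun τ hτ ε hε => ?_)
      intervalIntegrable_const (.of_forall fun τ hτ ε hε => ?_)).2
    · exact ((cFε ε).mono uIoc_subset_uIcc).aestronglyMeasurable measurableSet_uIoc
    · refine ContinuousOn.aestronglyMeasurable ?_ measurableSet_uIoc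
      simp only [zero_mul, add_zero]
      exact (cG0.mul cH).mono (by rw [← uIcc_of_le hT]; exact uIoc_subset_uIcc)
    · rw [uIoc_of_le hT] at hτ
      exact hC (ε, τ) ⟨hε, hτ.1.le, hτ.2⟩
    · exact (hM.hasDerivAt_reducedFlow τ _).comp ε (hlin τ ε)
  have d2 := ((hasDerivAt_ratePrimitive (M := M) (A 0 + 0 * H 0)).comp (0 : ℝ)
    (hlin 0 0)).const_mul (M.discount 0 * M.B)
  refine HasDerivAt.congr_deriv (d2.add d1) ?_
  simp only [zero_mul, add_zero]
  -- integration by parts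
  have hgi : IntervalIntegrable (fun τ => M.marginalFlow τ (A τ)) volume 0 M.T := by
    apply ContinuousOn.intervalIntegrable
    rwa [uIcc_of_le hT]
  have acS := hgi.absolutelyContinuousOnInterval_intervalIntegral (c := 0) left_mem_uIcc
  have acH : AbsolutelyContinuousOnInterval H 0 M.T :=
    (absolutelyContinuous_pastEffort ib).sub (absolutelyContinuous_pastEffort ia)
  have key := acH.integral_mul_deriv_eq_deriv_mul acS
  have e1 : ∫ τ in (0 : ℝ)..M.T, H τ * deriv (fun s => ∫ τ in (0 : ℝ)..s, M.marginalFlow τ (A τ)) τ =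
      ∫ τ in (0 : ℝ)..M.T, M.marginalFlow τ (A τ) * H τ := by
    apply intervalIntegral.integral_congr_ae
    filter_upwards [hgi.ae_hasDerivAt_integral] with τ hτ hmem
    rw [(hτ (uIoc_subset_uIcc hmem) 0 left_mem_uIcc).deriv, mul_comm]
  have e2 : ∫ τ in (0 : ℝ)..M.T, deriv H τ * (∫ u in (0 : ℝ)..τ, M.marginalFlow u (A u)) =
      -∫ τ in (0 : ℝ)..M.T, (b τ - a τ) * (∫ u in (0 : ℝ)..τ, M.marginalFlow u (A u)) := by
    rw [← intervalIntegral.integral_neg]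
    apply intervalIntegral.integral_congr_ae
    filter_upwards [ae_hasDerivAt_pastEffort ia, ae_hasDerivAt_pastEffort ib] with τ hτa hτb hmem
    have hm := uIoc_subset_uIcc hmem
    rw [show deriv H τ = -b τ - -a τ from ((hτb hm).sub (hτa hm)).deriv]
    ring
  -- The value `H 0`, an integral of `b - a`, turns the terminal term into the constant part of the
  -- switching function; `H T = 0` removes the other boundary term.
  have hHT : H M.T = 0 := by simp [hH, A]
  have hH0 : H 0 = ∫ τ in (0 : ℝ)..M.T, (b τ - a τ) := by
    rw [intervalIntegral.integral_sub ib ia]; rfl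
  rw [e1, e2, hHT, intervalIntegral.integral_same] at key
  have hSi : IntervalIntegrable (fun τ => (b τ - a τ) *
      (∫ u in (0 : ℝ)..τ, M.marginalFlow u (A u))) volume 0 M.T :=
    (ib.sub ia).mul_continuousOn acS.continuousOn
  rw [key]
  simp only [switching, mul_add]
  rw [intervalIntegral.integral_add ((ib.sub ia).mul_const _) hSi,
    intervalIntegral.integral_mul_const, ← hH0]
  ring

/-- Policies form a convex set and past effort is linear in the policy, so moving from `a` towards
`b` stays admissible and cannot raise the payoff. -/
theorem Standing.variation_nonpos (hM : M.Standing) (h : M.IsOptimal a) (hb : M.IsPolicy b) :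
    ∫ τ in (0 : ℝ)..M.T, (b τ - a τ) * M.switching (M.pastEffort a) τ ≤ 0 := by
  refine (hM.first_variation h.1 hb).nonpos_of_le_right fun ε hε => ?_
  have hT := hM.T_pos.le
  have hc : M.IsPolicy fun τ => a τ + ε * (b τ - a τ) := by
    refine ⟨h.1.1.add ((hb.1.sub h.1.1).const_mul ε), fun τ hτ => ?_⟩
    have := h.1.2 τ hτ
    have := hb.2 τ hτ
    constructor <;> nlinarith [this.1, this.2, hε.1, hε.2, (h.1.2 τ hτ).1, (h.1.2 τ hτ).2]
  have hpe : ∀ τ ∈ Icc 0 M.T, M.pastEffort (fun τ => a τ + ε * (b τ - a τ)) τ =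
      M.pastEffort a τ + ε * (M.pastEffort b τ - M.pastEffort a τ) := by
    intro τ hτ
    have ia := h.1.intervalIntegrable hτ ⟨hT, le_rfl⟩
    have ib := hb.intervalIntegrable hτ ⟨hT, le_rfl⟩
    simp only [pastEffort]
    rw [intervalIntegral.integral_add ia ((ib.sub ia).const_mul ε),
      intervalIntegral.integral_const_mul, intervalIntegral.integral_sub ib ia]
  have hle := h.2 _ hc
  rw [hM.payoff_eq h.1, hM.payoff_eq hc] at hle
  convert hle using 1
  · simp only [reducedPayoff, hpe 0 ⟨le_rfl, hT⟩]
    congr 1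
    apply intervalIntegral.integral_congr
    intro τ hτ
    rw [uIcc_of_le hT] at hτ
    simp only [hpe τ hτ]
  · simp

/-- Bang-bang control where the switching function does not vanish. -/
theorem Standing.ae_eq_of_switching (hM : M.Standing) (h : M.IsOptimal a) :
    ∀ᵐ τ ∂(volume.restrict (Ioc 0 M.T)),
      (0 < M.switching (M.pastEffort a) τ → a τ = 1) ∧
      (M.switching (M.pastEffort a) τ < 0 → a τ = 0) := by
  have hT := hM.T_pos.le
  have hgc := hM.continuousOn_comp hM.continuous_marginalFlow h.1
  have hgi : IntervalIntegrable (fun τ => M.marginalFlow τ (M.pastEffort a τ)) volume 0 M.T := by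
    apply ContinuousOn.intervalIntegrable
    rwa [uIcc_of_le hT]
  have hφc : ContinuousOn (M.switching (M.pastEffort a)) (Icc 0 M.T) := by
    have := (hgi.absolutelyContinuousOnInterval_intervalIntegral (c := 0)
      left_mem_uIcc).continuousOn
    rw [uIcc_of_le hT] at this
    exact continuousOn_const.add this
  set φ := M.switching (M.pastEffort a)
  have hφm : AEMeasurable φ (volume.restrict (Icc 0 M.T)) := hφc.aemeasurable measurableSet_Icc
  classical
  -- The pointwise maximizer of `b τ * φ τ`, equal to `a` where `φ` vanishes. The variation towards
  -- it has a nonnegative integrand and a nonpositive integral, so the integrand is zero almost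
  -- everywhere.
  set b : ℝ → ℝ := fun τ => if 0 < φ τ then 1 else if φ τ < 0 then 0 else a τ with hbdef
  have hb : M.IsPolicy b := by
    constructor
    · have n1 : NullMeasurableSet {τ | 0 < φ τ} (volume.restrict (Icc 0 M.T)) :=
        nullMeasurableSet_lt aemeasurable_const hφm
      have n2 : NullMeasurableSet {τ | φ τ = 0} (volume.restrict (Icc 0 M.T)) :=
        nullMeasurableSet_eq_fun hφm aemeasurable_const
      have := ((aemeasurable_const (b := (1 : ℝ))).indicator₀ n1).add (h.1.1.indicator₀ n2)
      convert this using 1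
      ext τ
      simp only [hbdef, Pi.add_apply, indicator_apply, mem_ofPred_eq]
      rcases lt_trichotomy (φ τ) 0 with h1 | h1 | h1
      · simp [h1, h1.ne]
      · simp [h1]
      · simp [h1, h1.ne']
    · intro τ hτ
      have := h.1.2 τ hτ
      simp only [hbdef]
      split_ifs
      · simp
      · simp
      · exact this
  have hv := hM.variation_nonpos h hb
  have hnn : ∀ τ ∈ Ioc 0 M.T, 0 ≤ (b τ - a τ) * φ τ := by
    intro τ hτ
    have := h.1.2 τ ⟨hτ.1.le, hτ.2⟩
    simp only [hbdef]
    split_ifs with h1 h2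
    · exact mul_nonneg (by linarith [this.2]) h1.le
    · exact mul_nonneg_of_nonpos_of_nonpos (by linarith [this.1]) h2.le
    · simp
  have hint : IntervalIntegrable (fun τ => (b τ - a τ) * φ τ) volume 0 M.T := by
    have ia := h.1.intervalIntegrable (x := 0) (y := M.T) ⟨le_rfl, hT⟩ ⟨hT, le_rfl⟩
    have ib := hb.intervalIntegrable (x := 0) (y := M.T) ⟨le_rfl, hT⟩ ⟨hT, le_rfl⟩
    exact (ib.sub ia).mul_continuousOn (by rwa [uIcc_of_le hT])
  have hae : 0 ≤ᵐ[volume.restrict (Ioc 0 M.T)] fun τ => (b τ - a τ) * φ τ :=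
    (ae_restrict_iff' measurableSet_Ioc).2 (.of_forall hnn)
  have hzero : ∫ τ in (0 : ℝ)..M.T, (b τ - a τ) * φ τ = 0 :=
    le_antisymm hv (intervalIntegral.integral_nonneg_of_ae_restrict hT (by
      rwa [← restrict_Ioc_eq_restrict_Icc]))
  rw [intervalIntegral.integral_eq_zero_iff_of_le_of_nonneg_ae hT hae hint] at hzero
  filter_upwards [hzero] with τ hτ
  simp only [Pi.zero_apply, mul_eq_zero] at hτ
  constructor <;> intro hs
  · rcases hτ with hτ | hτ
    · simp only [hbdef, if_pos hs] at hτ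
      linarith
    · linarith
  · rcases hτ with hτ | hτ
    · simp only [hbdef, if_neg (not_lt.2 hs.le), if_pos hs] at hτ
      linarith
    · linarith

end DoThinkProblem
end

/-! ### Existence by compactness of effort paths -/

noncomputable section
namespace DoThinkProblem

variable {M : DoThinkProblem} {a b : ℝ → ℝ}

/-- Paths of past effort, as functions of the time remaining. -/
def effortPaths (M : DoThinkProblem) (hT : 0 ≤ M.T) :
    Set (BoundedContinuousFunction (Icc 0 M.T) ℝ) :=
  {f | f ⟨M.T, hT, le_rfl⟩ = 0 ∧ ∀ x y : Icc 0 M.T, x ≤ y → f x - f y ∈ Icc 0 (y.1 - x.1)}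

theorem lipschitzWith_of_mem_effortPaths {hT : 0 ≤ M.T}
    {f : BoundedContinuousFunction (Icc 0 M.T) ℝ} (hf : f ∈ M.effortPaths hT) :
    LipschitzWith 1 f := by
  refine LipschitzWith.of_le_add fun x y => ?_
  rw [Subtype.dist_eq, Real.dist_eq]
  rcases le_total x y with hxy | hxy
  · have h := sub_nonneg.2 (Subtype.coe_le_coe.2 hxy)
    rw [abs_sub_comm, abs_of_nonneg h]
    linarith [(hf.2 x y hxy).2]
  · linarith [(hf.2 y x hxy).1, abs_nonneg (x.1 - y.1)]

theorem isCompact_effortPaths (hT : 0 ≤ M.T) : IsCompact (M.effortPaths hT) := by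
  refine BoundedContinuousFunction.arzela_ascoli₂ (Icc 0 M.T) isCompact_Icc _ ?_ ?_ ?_
  · have : M.effortPaths hT = {f | f ⟨M.T, hT, le_rfl⟩ = 0} ∩
        ⋂ (x : Icc 0 M.T) (y : Icc 0 M.T) (_ : x ≤ y), {f | f x - f y ∈ Icc 0 (y.1 - x.1)} := by
      ext f; simp only [effortPaths, mem_ofPred_eq, mem_inter_iff, mem_iInter]
    rw [this]
    have hc : ∀ x : Icc 0 M.T,
        Continuous fun f : BoundedContinuousFunction (Icc 0 M.T) ℝ => f x := fun x =>
      continuous_eval_const x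
    refine (isClosed_eq (hc _) continuous_const).inter ?_
    refine isClosed_iInter fun x => isClosed_iInter fun y => isClosed_iInter fun _ => ?_
    exact isClosed_Icc.preimage ((hc x).sub (hc y))
  · intro f x hf
    have h := hf.2 x ⟨M.T, hT, le_rfl⟩ x.2.2
    rw [hf.1, sub_zero] at h
    exact ⟨h.1, h.2.trans (sub_le_self _ x.2.1)⟩
  · exact (LipschitzWith.uniformEquicontinuous _ 1 fun f =>
      lipschitzWith_of_mem_effortPaths f.2).equicontinuous

theorem IsPolicy.exists_mem_effortPaths (hT : 0 ≤ M.T) (h : M.IsPolicy a) :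
    ∃ f ∈ M.effortPaths hT, ∀ x : Icc 0 M.T, f x = M.pastEffort a x := by
  refine ⟨BoundedContinuousFunction.mkOfCompact ⟨(Icc 0 M.T).domRestrict (M.pastEffort a),
    (h.continuousOn_pastEffort hT).domRestrict⟩, ⟨?_, ?_⟩, fun x => rfl⟩
  · exact pastEffort_T
  · exact fun x y hxy => h.pastEffort_sub_mem x.2 y.2 hxy

/-- Every path of past effort comes from a policy. -/
theorem exists_policy_of_mem_effortPaths {hT : 0 ≤ M.T}
    {f : BoundedContinuousFunction (Icc 0 M.T) ℝ} (hf : f ∈ M.effortPaths hT) :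
    ∃ a, M.IsPolicy a ∧ ∀ x : Icc 0 M.T, f x = M.pastEffort a x := by
  set x : ℝ → ℝ := fun τ => f (projIcc 0 M.T hT τ) with hx
  have hlip : LipschitzWith 1 x := by
    have := (lipschitzWith_of_mem_effortPaths hf).comp (LipschitzWith.projIcc hT)
    rwa [mul_one] at this
  have hanti : Antitone x := fun s t hst =>
    sub_nonneg.1 (hf.2 _ _ (monotone_projIcc hT hst)).1
  -- The bounds hold at every point: where `x` is not differentiable, `deriv x` is `0`.
  refine ⟨fun τ => -deriv x τ, ⟨(measurable_deriv x).neg.aemeasurable, fun τ _ => ?_⟩, ?_⟩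
  · have h1 : ‖deriv x τ‖ ≤ (1 : NNReal) := norm_deriv_le_of_lipschitz hlip
    have h2 : deriv x τ ≤ 0 := hanti.deriv_nonpos
    rw [Real.norm_eq_abs, abs_le, NNReal.coe_one] at h1
    constructor <;> linarith [h1.1]
  · intro τ
    have hac : AbsolutelyContinuousOnInterval x τ M.T :=
      (hlip.lipschitzOnWith (s := uIcc τ.1 M.T)).absolutelyContinuousOnInterval
    rw [pastEffort, intervalIntegral.integral_neg, hac.integral_deriv_eq_sub]
    simp only [hx, projIcc_val, projIcc_right, hf.1]
    ring

theorem reducedPayoff_congr (hT : 0 ≤ M.T) {x y : ℝ → ℝ} (h : ∀ τ ∈ Icc 0 M.T, x τ = y τ) :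
    M.reducedPayoff x = M.reducedPayoff y := by
  rw [reducedPayoff, reducedPayoff, h 0 ⟨le_rfl, hT⟩]
  congr 1
  apply intervalIntegral.integral_congr
  intro τ hτ
  rw [uIcc_of_le hT] at hτ
  simp only [h τ hτ]

/-- After integration by parts no derivative of the path is left in the payoff, so uniform
convergence of paths suffices for continuity. -/
theorem Standing.exists_isOptimal (hM : M.Standing) : ∃ a, M.IsOptimal a := by
  have hT := hM.T_pos.le
  set J : BoundedContinuousFunction (Icc 0 M.T) ℝ → ℝ := fun f =>
    M.reducedPayoff fun τ => f (projIcc 0 M.T hT τ) with hJ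
  have hpay : ∀ a, M.IsPolicy a → ∀ f : BoundedContinuousFunction (Icc 0 M.T) ℝ,
      (∀ x : Icc 0 M.T, f x = M.pastEffort a x) → M.payoff a = J f := by
    intro a ha f hf
    rw [hM.payoff_eq ha]
    apply reducedPayoff_congr hT
    intro τ hτ
    rw [hf, projIcc_of_mem hT hτ]
  have hJc : Continuous J := by
    have ce : Continuous fun z : BoundedContinuousFunction (Icc 0 M.T) ℝ × ℝ =>
        z.1 (projIcc 0 M.T hT z.2) :=
      continuous_fst.eval
        (continuous_projIcc.comp continuous_snd)
    refine Continuous.add ?_ ?_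
    · exact continuous_const.mul (continuous_ratePrimitive.comp
        (continuous_eval_const _))
    · have hjoint : Continuous fun z : BoundedContinuousFunction (Icc 0 M.T) ℝ × ℝ =>
          M.reducedFlow z.2 (z.1 (projIcc 0 M.T hT z.2)) :=
        hM.continuous_reducedFlow.comp (continuous_snd.prodMk ce)
      exact intervalIntegral.continuous_parametric_intervalIntegral_of_continuous'
        (f := fun (f : BoundedContinuousFunction (Icc 0 M.T) ℝ) τ =>
          M.reducedFlow τ (f (projIcc 0 M.T hT τ))) hjoint 0 M.T
  have hone : M.IsPolicy fun _ => 1 := ⟨aemeasurable_const, fun _ _ => by simp⟩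
  obtain ⟨f₁, hf₁, -⟩ := hone.exists_mem_effortPaths hT
  obtain ⟨f, hf, hmax⟩ := (isCompact_effortPaths hT).exists_isMaxOn ⟨f₁, hf₁⟩ hJc.continuousOn
  obtain ⟨a, ha, hfa⟩ := exists_policy_of_mem_effortPaths hf
  refine ⟨a, ha, fun b hb => ?_⟩
  obtain ⟨fb, hfb, hfb'⟩ := hb.exists_mem_effortPaths hT
  rw [hpay a ha f hfa, hpay b hb fb hfb']
  exact hmax hfb

/-! ### Form of the optimal policies -/

/-- An optimal policy does, up to a null set, except on an interval of thinking. -/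
theorem Standing.exists_thinking_interval (hM : M.Standing) (h : M.IsOptimal a) :
    M.DoThroughout a ∨ ∃ s r, 0 < s ∧ s < r ∧ r ≤ M.T ∧
      DoesOn a r M.T ∧ ThinksOn a s r ∧ DoesOn a 0 s := by
  have hT := hM.T_pos.le
  have hnn : ∀ τ ∈ Icc 0 M.T, 0 ≤ M.pastEffort a τ := fun τ hτ => h.1.pastEffort_nonneg hτ
  -- With this factor positive, the marginal flow has the sign of the advantage.
  have hfac : ∀ τ, 0 < M.discount τ * M.scaledSurvival (M.pastEffort a τ) := fun τ =>
    mul_pos (discount_pos τ) (hM.scaledSurvival_pos _)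
  have hae := hM.ae_eq_of_switching h
  -- The exceptional point `z` allows `φ` to touch zero once without any thinking.
  have hdo : ∀ r s : ℝ, 0 ≤ r → s ≤ M.T → ∀ z,
      (∀ τ ∈ Ioo r s, τ ≠ z → 0 < M.switching (M.pastEffort a) τ) → DoesOn a r s := by
    intro r s hr hs z hpos
    rw [DoesOn]
    have hz : ∀ᵐ τ ∂(volume.restrict (Ioo r s)), τ ≠ z := Measure.ae_ne _ z
    filter_upwards [ae_restrict_of_ae_restrict_of_subset
      (fun τ (hτ : τ ∈ Ioo r s) => show τ ∈ Ioc 0 M.T from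
        ⟨hr.trans_lt hτ.1, hτ.2.le.trans hs⟩) hae, hz,
      ae_restrict_mem measurableSet_Ioo] with τ h1 h2 h3
    exact h1.1 (hpos τ h3 h2)
  rcases exists_interval_of_single_crossing (T := M.T)
    (φ₀ := M.discount 0 * M.B * M.scaledRate (M.pastEffort a 0))
    (g := fun τ => M.marginalFlow τ (M.pastEffort a τ)) (φ := M.switching (M.pastEffort a))
    (mul_pos (mul_pos (discount_pos 0) hM.B_pos) (hM.scaledRate_pos _))
    (hM.continuousOn_comp hM.continuous_marginalFlow h.1) (fun _ => rfl)
    (fun x hx y hy hxy hg => by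
      have hg' := nonneg_of_mul_nonneg_right hg (hfac x)
      exact mul_nonneg (hfac y).le (hg'.trans (hM.advantage_le_of_nonneg hx.1 hxy (hnn y hy)
        (h.1.pastEffort_antitoneOn hx hy hxy) hg')))
    (fun x hx y hy hxy hg => by
      have hg' := pos_of_mul_pos_right hg (hfac x).le
      exact mul_pos (hfac y) (hg'.trans_le (hM.advantage_le_of_nonneg hx.1 hxy (hnn y hy)
        (h.1.pastEffort_antitoneOn hx hy hxy) hg'.le)))
    with ⟨z, hz⟩ | ⟨s, r, hs, hsr, hr, hlow, hhigh, hmid⟩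
  · exact Or.inl (hdo 0 M.T le_rfl le_rfl z fun τ hτ hne => hz τ ⟨hτ.1.le, hτ.2.le⟩ hne)
  refine Or.inr ⟨s, r, hs, hsr, hr,
    hdo r M.T (hs.trans hsr).le le_rfl 0 fun τ hτ _ => hhigh τ ⟨hτ.1, hτ.2.le⟩, ?_,
    hdo 0 s le_rfl (hsr.le.trans hr) 0 fun τ hτ _ => hlow τ ⟨hτ.1.le, hτ.2⟩⟩
  rw [ThinksOn]
  rcases hmid with hneg | hzero
  · filter_upwards [ae_restrict_of_ae_restrict_of_subset
      (fun τ (hτ : τ ∈ Ioo s r) => show τ ∈ Ioc 0 M.T from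
        ⟨hs.trans hτ.1, hτ.2.le.trans hr⟩) hae,
      ae_restrict_mem measurableSet_Ioo] with τ h1 h3
    exact h1.2 (hneg τ h3)
  -- on a singular arc there has been no effort on the doing arm
  have hadv : ∀ τ ∈ Ioo s r, M.advantage (M.hazard (M.pastEffort a τ)) τ = 0 := fun τ hτ =>
    (mul_eq_zero.1 (hzero τ hτ)).resolve_left (hfac τ).ne'
  have hmem : ∀ τ ∈ Ioo s r, τ ∈ Icc 0 M.T := fun τ hτ =>
    ⟨(hs.trans hτ.1).le, hτ.2.le.trans hr⟩
  have hA : ∀ τ ∈ Ioo s r, M.pastEffort a τ = 0 := by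
    intro τ hτ
    obtain ⟨y, hy⟩ := exists_between hτ.2
    have hy' : y ∈ Ioo s r := ⟨hτ.1.trans hy.1, hy.2⟩
    exact hM.eq_zero_of_advantage_eq_zero (hmem τ hτ).1 hy.1 (hnn y (hmem y hy'))
      (h.1.pastEffort_antitoneOn (hmem τ hτ) (hmem y hy') hy.1.le) (hadv τ hτ) (hadv y hy')
  -- Past effort is constant on the arc, so its derivative `-a τ` vanishes almost everywhere there.
  have hder := ae_hasDerivAt_pastEffort
    (h.1.intervalIntegrable (x := 0) (y := M.T) ⟨le_rfl, hT⟩ ⟨hT, le_rfl⟩)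
  filter_upwards [ae_restrict_of_ae hder, ae_restrict_mem measurableSet_Ioo] with τ h1 h2
  have h3 := h1 (by rw [uIcc_of_le hT]; exact hmem τ h2)
  have h4 : HasDerivAt (M.pastEffort a) 0 τ := by
    refine (hasDerivAt_const τ (0 : ℝ)).congr_of_eventuallyEq ?_
    filter_upwards [Ioo_mem_nhds h2.1 h2.2] with t ht
    exact hA t ht
  linarith [h3.unique h4]

theorem thinksAtMostOnce_of_doesOn {s r : ℝ} (h1 : DoesOn a r M.T) (h2 : ThinksOn a s r)
    (h3 : DoesOn a 0 s) : M.ThinksAtMostOnce a := by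
  refine ⟨Ioo s r, ordConnected_Ioo, ?_⟩
  rw [DoesOn, ae_restrict_iff' measurableSet_Ioo] at h1 h3
  rw [ThinksOn, ae_restrict_iff' measurableSet_Ioo] at h2
  rw [ae_restrict_iff' measurableSet_Icc]
  filter_upwards [h1, h2, h3, Measure.ae_ne volume 0, Measure.ae_ne volume s,
    Measure.ae_ne volume r, Measure.ae_ne volume M.T] with τ h1 h2 h3 n0 ns nr nT hτ
  have l0 := lt_of_le_of_ne hτ.1 n0.symm
  have lT := lt_of_le_of_ne hτ.2 nT
  rcases ns.lt_or_gt with h | h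
  · simp [h3 ⟨l0, h⟩, h.le]
  rcases nr.lt_or_gt with h' | h'
  · simp [h2 ⟨h, h'⟩, h, h']
  · simp [h1 ⟨h', lT⟩, h'.le]

end DoThinkProblem
end

theorem proposition3 (M : DoThinkProblem)
    (hT : 0 < M.T) (hc : 0 < M.c) (hlam : 0 < M.lam) (hmu : 0 < M.mu) (hB : 0 < M.B)
    (hp0 : 0 < M.pbar) (hp1 : M.pbar < 1)
    (hV : ContDiffOn ℝ 3 M.V (Set.Ici 0)) (hV0 : M.V 0 = 0)
    (hV' : ∀ τ ∈ Set.Ici (0 : ℝ), 0 < derivWithin M.V (Set.Ici 0) τ)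
    (hV'' : ∀ τ ∈ Set.Ici (0 : ℝ),
      M.pbar * M.lam ≤
        -derivWithin (derivWithin M.V (Set.Ici 0)) (Set.Ici 0) τ /
          derivWithin M.V (Set.Ici 0) τ) :
    (∃ a, M.IsOptimal a) ∧
      ∀ a, M.IsOptimal a →
        (M.DoThroughout a ∨ M.ThinkThenDo a ∨ M.DoThinkDo a) ∧ M.ThinksAtMostOnce a := by
  have hM : M.Standing := ⟨hT, hc, hlam, hmu, hB, hp0, hp1, hV, hV0, hV', hV''⟩
  refine ⟨hM.exists_isOptimal, fun a ha => ?_⟩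
  rcases hM.exists_thinking_interval ha with h | ⟨s, r, hs, hsr, hr, h1, h2, h3⟩
  -- Doing throughout is the case of an empty thinking interval, placed at `T`.
  · refine ⟨Or.inl h, DoThinkProblem.thinksAtMostOnce_of_doesOn (s := M.T) (r := M.T)
      ?_ ?_ h⟩ <;> simp [DoThinkProblem.DoesOn, DoThinkProblem.ThinksOn]
  refine ⟨Or.inr ?_, DoThinkProblem.thinksAtMostOnce_of_doesOn h1 h2 h3⟩
  -- An initial phase of doing exists exactly when `r < T`.
  rcases hr.lt_or_eq with hlt | rfl
  · exact Or.inr ⟨s, r, hs, hsr, hlt, h1, h2, h3⟩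
  · exact Or.inl ⟨s, hs, hsr, h2, h3⟩
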